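/- Call a set $\mathcal C\subset\mathbb R^2$ an algebraic curve of constant width $\alpha>0$ if $\mathcal C=\gamma([-\pi,\pi])$ with $$\gamma(\theta)=\bigl(p(\theta)\cos\theta-p'(\theta)\sin\theta,\; p(\theta)\sin\theta+p'(\theta)\cos\theta\bigr),$$ where $p$ is a trigonometric polynomial of the form $$p(\theta)=\frac{\alpha}{2}+\sum_{k=0}^{N}\bigl(a_{2k+1}\cos(2k+1)\theta+b_{2k+1}\sin(2k+1)\theta\bigr),\qquad N\ge 0,\ a_{2k+1},b_{2k+1}\in\mathbb R,$$ such that $p+p''\ge 0$ on $\mathbb R$ (that is, $p$ is the support function of the convex region bounded by $\mathcal C$). Call it non-circular if it is not a circle. A defining polynomial of $\mathcal C$ is an irreducible $f\in\mathbb R[x,y]$ that generates the ideal of all polynomials in $\mathbb R[x,y]$ vanishing on $\mathcal C$; degree means total degree. Then the minimal degree of a defining polynomial of a non-circular algebraic curve of constant width (over all $\alpha>0$) is $8$. Moreover, every nonzero polynomial in $\mathbb R[x,y]$ that vanishes on a non-circular algebraic curve of constant width has degree at least $8$. The value $8$ is attained, for example, for $\alpha=1$ and $p(\theta)=\tfrac12+\tfrac1{16}\cos3\theta$: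 the corresponding curve is a non-circular algebraic curve of constant width $1$ and has a defining polynomial of degree $8$. -/

import Mathlib

open Real

/-- The parametrization
`γ(θ) = (p(θ) cos θ - p'(θ) sin θ, p(θ) sin θ + p'(θ) cos θ)`. If `p` is the smooth support function
of a compact convex set, it traces the boundary of that set. -/
noncomputable def supportParam (p : ℝ → ℝ) (θ : ℝ) : EuclideanSpace ℝ (Fin 2) :=
  !₂[p θ * cos θ - deriv p θ * sin θ, p θ * sin θ + deriv p θ * cos θ]

/-- The set of points traced by `supportParam p` on `[-π, π]`. -/
noncomputable def supportCurve (p : ℝ → ℝ) : Set (EuclideanSpace ℝ (Fin 2)) :=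
  supportParam p '' Set.Icc (-π) π

/-- `p` is a trigonometric polynomial with constant term `α / 2`, `α > 0`, and all other harmonics
odd, which satisfies the convexity condition `p + p'' ≥ 0`. -/
def IsConstantWidthSupport (α : ℝ) (p : ℝ → ℝ) : Prop :=
  0 < α ∧
  (∃ (N : ℕ) (a b : ℕ → ℝ), ∀ θ : ℝ,
    p θ = α / 2 + ∑ k ∈ Finset.range (N + 1),
      (a k * cos ((2 * (k : ℝ) + 1) * θ) + b k * sin ((2 * (k : ℝ) + 1) * θ))) ∧
  ∀ θ : ℝ, 0 ≤ p θ + deriv (deriv p) θ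

/-- `C` is an algebraic curve of constant width `α`: it is the curve with support function a
trigonometric polynomial as above. -/
def IsAlgebraicCurveOfConstantWidth (α : ℝ) (C : Set (EuclideanSpace ℝ (Fin 2))) : Prop :=
  ∃ p : ℝ → ℝ, IsConstantWidthSupport α p ∧ C = supportCurve p

/-- `C` is a Euclidean circle. -/
def IsCircle (C : Set (EuclideanSpace ℝ (Fin 2))) : Prop :=
  ∃ (c : EuclideanSpace ℝ (Fin 2)) (r : ℝ), C = Metric.sphere c r

/-- The polynomial `g ∈ ℝ[x, y]` is zero at every point of `C`. -/
def VanishesOn (g : MvPolynomial (Fin 2) ℝ) (C : Set (EuclideanSpace ℝ (Fin 2))) : Prop :=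
  ∀ P ∈ C, MvPolynomial.eval (fun i => P i) g = 0

/-- `f` is a defining polynomial of `C`: it is irreducible in `ℝ[x, y]` and generates the ideal of
all polynomials that vanish on `C` (so `f = 0` is the equation of the Zariski closure of `C`, and
`f` is unique up to a nonzero constant factor). -/
def IsDefiningPolynomial (f : MvPolynomial (Fin 2) ℝ)
    (C : Set (EuclideanSpace ℝ (Fin 2))) : Prop :=
  Irreducible f ∧ ∀ g : MvPolynomial (Fin 2) ℝ, VanishesOn g C ↔ f ∣ g

/-- The support function `p(θ) = 1/2 + (1/16) cos 3θ`. -/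
noncomputable def exampleSupport (θ : ℝ) : ℝ := 1 / 2 + 1 / 16 * cos (3 * θ)

/-!
With `T = exp(iθ)`, a trigonometric polynomial `p` becomes a Laurent polynomial `P` in `T`, and so
do `x + iy = T (P - T P')` and `x - iy = T⁻¹ (P + T P')`. Let `L ⊆ ℂ(T)` be the field generated by
`x` and `y`. The tangent at `θ` is orthogonal to `(cos θ, sin θ)`, that is,
`d(x + iy) = -T² d(x - iy)`; both differentials are multiples of `dy` with coefficients in `L`,
because `ℂ(T)` is separable over `ℂ(y)`, so `T² ∈ L`. All frequencies of `p` other than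
`0` are odd and its mean is not zero, so `x + iy` has a nonzero odd coefficient, which lets one
extract `T ∈ L`. Hence the equation of the curve has degree at least `[ℂ(T) : ℂ(y)] = 2 (n + 1)` in
`x`, where `n` is the top frequency of `p`. For `n ≤ 1` the curve is a circle; otherwise `n ≥ 3`.

For `p = 1/2 + (1/16) cos 3θ`, eliminating `cos 3θ` gives an octic that vanishes on the curve. It is
monic in `x`, so division with remainder shows that it divides every polynomial vanishing there.
-/

section FieldTheory

open IntermediateField Polynomial

variable {k K : Type*} [Field k] [Field K] [Algebra k K]

theorem exists_mem_derivation_eq_smul_of_mem_adjoin {M : Type*} [AddCommGroup M] [Module k M]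
    [Module K M] (D : Derivation k K M) {x a : K} (ha : a ∈ k⟮x⟯) : ∃ c ∈ k⟮x⟯, D a = c • D x := by
  induction ha using adjoin_induction with
  | mem a ha => exact ⟨1, one_mem _, by rw [one_smul, Set.mem_singleton_iff.mp ha]⟩
  | algebraMap r => exact ⟨0, zero_mem _, by rw [D.map_algebraMap, zero_smul]⟩
  | add a b _ _ iha ihb =>
    obtain ⟨c, hc, hca⟩ := iha
    obtain ⟨d, hd, hdb⟩ := ihb
    exact ⟨c + d, add_mem hc hd, by rw [map_add, hca, hdb, add_smul]⟩
  | inv a ha iha =>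
    obtain ⟨c, hc, hca⟩ := iha
    exact ⟨-a⁻¹ ^ 2 * c, mul_mem (neg_mem (pow_mem (inv_mem ha) 2)) hc,
      by rw [D.leibniz_inv, hca, smul_smul]⟩
  | mul a b ha hb iha ihb =>
    obtain ⟨c, hc, hca⟩ := iha
    obtain ⟨d, hd, hdb⟩ := ihb
    exact ⟨a * d + b * c, add_mem (mul_mem ha hd) (mul_mem hb hc),
      by rw [D.leibniz, hca, hdb, smul_smul, smul_smul, add_smul]⟩

theorem exists_mem_derivation_eq_smul {M : Type*} [AddCommGroup M] [Module k M] [Module K M]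
    (D : Derivation k K M) {L : IntermediateField k K} {x y : K} (hx : x ∈ L) (hy : y ∈ L)
    (hsep : IsSeparable k⟮x⟯ y) : ∃ c ∈ L, D y = c • D x := by
  have hsub : k⟮x⟯ ≤ L := adjoin_simple_le_iff.mpr hx
  have hchain (P : k⟮x⟯[X]) : ∃ c ∈ L, D (aeval y P) = c • D x + aeval y P.derivative • D y := by
    induction P using Polynomial.induction_on' with
    | add P Q ihP ihQ =>
      obtain ⟨c, hc, hP⟩ := ihP
      obtain ⟨d, hd, hQ⟩ := ihQ
      refine ⟨c + d, add_mem hc hd, ?_⟩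
      rw [derivative_add, map_add, map_add, map_add, hP, hQ, add_smul, add_smul]
      abel
    | monomial n a =>
      obtain ⟨c, hc, ha⟩ := exists_mem_derivation_eq_smul_of_mem_adjoin D a.2
      refine ⟨y ^ n * c, mul_mem (pow_mem hy n) (hsub hc), ?_⟩
      rw [aeval_monomial, derivative_monomial, aeval_monomial, D.leibniz, D.leibniz_pow,
        IntermediateField.algebraMap_apply, ha, smul_smul, add_comm, map_mul, map_natCast,
        IntermediateField.algebraMap_apply, ← Nat.cast_smul_eq_nsmul K, smul_smul, smul_smul,
        mul_assoc]
  obtain ⟨c, hc, hD⟩ := hchain (minpoly k⟮x⟯ y)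
  set s := aeval y (minpoly k⟮x⟯ y).derivative
  have hs : s ≠ 0 := hsep.aeval_derivative_ne_zero (minpoly.aeval _ y)
  have hsL : s ∈ L := by
    rw [show s = _ from aeval_eq_sum_range _]
    exact sum_mem fun i _ => mul_mem (hsub (SetLike.coe_mem _)) (pow_mem hy i)
  refine ⟨-s⁻¹ * c, mul_mem (neg_mem (inv_mem hsL)) hc, ?_⟩
  rw [minpoly.aeval, map_zero, eq_comm, add_eq_zero_iff_neg_eq] at hD
  rw [neg_mul, neg_smul, mul_smul, ← smul_neg, hD, inv_smul_smul₀ hs]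

theorem kaehlerDifferential_ne_zero_of_isSeparable [Algebra.EssFiniteType k K] {x : K}
    (hx : Transcendental k x) [Algebra.IsSeparable k⟮x⟯ K] : KaehlerDifferential.D k K x ≠ 0 := by
  intro hDx
  have hD (y : K) : KaehlerDifferential.D k K y = 0 := by
    obtain ⟨c, -, hc⟩ := exists_mem_derivation_eq_smul (KaehlerDifferential.D k K)
      (L := ⊤) (mem_top (x := x)) (mem_top (x := y)) (Algebra.IsSeparable.isSeparable _ y)
    rw [hc, hDx, smul_zero]
  have htop : (⊤ : Submodule K Ω[K⁄k]) = ⊥ := by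
    rw [← KaehlerDifferential.span_range_derivation, Submodule.span_eq_bot]
    rintro _ ⟨y, rfl⟩
    exact hD y
  have : Algebra.FormallyUnramified k K :=
    ⟨(Submodule.subsingleton_iff K).mp (subsingleton_of_bot_eq_top htop.symm)⟩
  have := (Algebra.FormallyUnramified.iff_isSeparable k K).mp this
  exact hx (Algebra.IsAlgebraic.isAlgebraic x)

theorem finrank_adjoin_tail_le_degreeOf {n : ℕ} {x : Fin (n + 1) → K}
    (hind : AlgebraicIndependent k (Fin.tail x)) (htop : adjoin k (Set.range x) = ⊤)
    {G : MvPolynomial (Fin (n + 1)) k} (hG : G ≠ 0) (hGx : MvPolynomial.aeval x G = 0) :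
    Module.finrank (adjoin k (Set.range (Fin.tail x))) K ≤ G.degreeOf 0 := by
  set F := adjoin k (Set.range (Fin.tail x)) with hF
  have hFtop : F⟮x 0⟯ = ⊤ := by
    rw [← restrictScalars_eq_top_iff (K := k), hF, adjoin_adjoin_left, ← htop, Set.union_comm]
    conv_rhs => rw [← Fin.cons_self_tail x, Fin.range_cons]
    rfl
  let φ : MvPolynomial (Fin n) k →ₐ[k] F :=
    MvPolynomial.aeval fun i => ⟨Fin.tail x i, subset_adjoin k _ ⟨i, rfl⟩⟩
  have hφx : F.val.comp φ = MvPolynomial.aeval (Fin.tail x) := by ext i; simp [φ]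
  have hφ : Function.Injective φ := by
    refine Function.Injective.of_comp (f := F.val) ?_
    rw [← AlgHom.coe_comp, hφx]
    exact algebraicIndependent_iff_injective_aeval.mp hind
  set H := (MvPolynomial.finSuccEquiv k n G).map φ.toRingHom
  have hH : H ≠ 0 := (Polynomial.map_ne_zero_iff hφ).mpr (by simpa using hG)
  have hroot : aeval (x 0) H = 0 := by
    have : ((aeval (x 0)).restrictScalars k).comp
        ((mapAlgHom φ).comp (MvPolynomial.finSuccEquiv k n).toAlgHom) = MvPolynomial.aeval x := by
      ext i
      refine Fin.cases ?_ (fun j => ?_) i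
      · simp [MvPolynomial.finSuccEquiv_X_zero]
      · simp [MvPolynomial.finSuccEquiv_X_succ, φ, Fin.tail]
    rw [← hGx, ← this]
    rfl
  have hint : IsIntegral F (x 0) := isAlgebraic_iff_isIntegral.mp ⟨_, hH, hroot⟩
  calc Module.finrank F K = Module.finrank F F⟮x 0⟯ := by rw [hFtop, finrank_top']
    _ = (minpoly F (x 0)).natDegree := adjoin.finrank hint
    _ ≤ H.natDegree := natDegree_le_natDegree (minpoly.degree_le_of_ne_zero _ _ hH hroot)
    _ ≤ (MvPolynomial.finSuccEquiv k n G).natDegree := natDegree_map_le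
    _ = G.degreeOf 0 := MvPolynomial.natDegree_finSuccEquiv G

end FieldTheory

section Laurent

open LaurentPolynomial

section Aeval

variable {R A : Type*} [CommRing R] [CommRing A] [Algebra R A]

/-- The `R`-algebra homomorphism `R[T;T⁻¹] → A` that sends `T` to the unit `u`. -/
noncomputable def laurentAeval (u : Aˣ) : R[T;T⁻¹] →ₐ[R] A :=
  { LaurentPolynomial.eval₂ (algebraMap R A) u with
    commutes' := fun r => LaurentPolynomial.eval₂_C (algebraMap R A) u r }

theorem laurentAeval_T (u : Aˣ) (n : ℤ) : laurentAeval u (T n : R[T;T⁻¹]) = (u ^ n : Aˣ) :=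
  LaurentPolynomial.eval₂_T (algebraMap R A) u n

theorem laurentAeval_C (u : Aˣ) (r : R) : laurentAeval u (C r) = algebraMap R A r :=
  LaurentPolynomial.eval₂_C (algebraMap R A) u r

theorem sum_support_C_mul_T (f : R[T;T⁻¹]) : ∑ n ∈ f.coeff.support, C (f.coeff n) * T n = f := by
  simp_rw [← LaurentPolynomial.single_eq_C_mul_T]
  exact AddMonoidAlgebra.sum_coeff_single f

theorem laurentAeval_eq_sum (u : Aˣ) (f : R[T;T⁻¹]) :
    laurentAeval u f = ∑ n ∈ f.coeff.support, algebraMap R A (f.coeff n) * (u ^ n : Aˣ) := by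
  conv_lhs => rw [← sum_support_C_mul_T f]
  simp only [map_sum, map_mul, laurentAeval_C, laurentAeval_T]

theorem coeff_mul_T (f : R[T;T⁻¹]) (m n : ℤ) : (f * T m).coeff n = f.coeff (n - m) := by
  rw [T, AddMonoidAlgebra.coeff_mul_single_eq_coeff_mul (n - m)
    fun i _ => (eq_sub_iff_add_eq (a := i) (b := n) (c := m)).symm, mul_one]

/-- The Euler operator `T d/dT`. Along `T = exp(iθ)` it is `-i d/dθ`. -/
noncomputable def euler : R[T;T⁻¹] →ₗ[R] R[T;T⁻¹] where
  toFun f := .ofCoeff (Finsupp.onFinset f.coeff.support (fun n => n * f.coeff n) fun _ hn =>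
    Finsupp.mem_support_iff.mpr (right_ne_zero_of_mul hn))
  map_add' _ _ := LaurentPolynomial.ext fun _ => mul_add _ _ _
  map_smul' _ _ := LaurentPolynomial.ext fun _ => mul_left_comm _ _ _

theorem coeff_euler (f : R[T;T⁻¹]) (n : ℤ) : (euler f).coeff n = n * f.coeff n := rfl

theorem euler_C_mul_T (r : R) (n : ℤ) : euler (C r * T n) = C (n * r) * T n := by
  ext m
  simp only [coeff_euler, coeff_mul_T, LaurentPolynomial.C_apply, sub_eq_zero, mul_ite, mul_zero]
  split_ifs with h
  · rw [h]
  · rfl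

end Aeval

variable {k : Type*} [Field k]

theorem derivation_laurentAeval {K M : Type*} [Field K] [Algebra k K] [AddCommGroup M] [Module k M]
    [Module K M] (D : Derivation k K M) (u : Kˣ) (f : k[T;T⁻¹]) :
    D (laurentAeval u f) = (laurentAeval u (euler f) * (u : K)⁻¹) • D (u : K) := by
  induction f using LaurentPolynomial.induction_on' with
  | add f g hf hg => simp only [map_add, hf, hg, add_mul, add_smul]
  | C_mul_T n r =>
    rw [euler_C_mul_T]
    simp only [map_mul, laurentAeval_C, laurentAeval_T, Units.val_zpow_eq_zpow_val]
    rw [D.leibniz, D.map_algebraMap, smul_zero, add_zero, D.leibniz_zpow, zpow_sub_one₀ u.ne_zero,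
      ← Int.cast_smul_eq_zsmul K, smul_smul, smul_smul]
    congr 1
    simp only [map_intCast]
    ring

/-- The embedding of Laurent polynomials into rational functions, `T ↦ X`. -/
noncomputable def laurentToRatFunc : k[T;T⁻¹] →ₐ[k] RatFunc k :=
  laurentAeval (Units.mk0 RatFunc.X RatFunc.X_ne_zero)

theorem laurentToRatFunc_T (n : ℤ) :
    laurentToRatFunc (T n : k[T;T⁻¹]) = (RatFunc.X : RatFunc k) ^ n := by
  rw [laurentToRatFunc, laurentAeval_T, Units.val_zpow_eq_zpow_val, Units.val_mk0]

theorem laurentToRatFunc_toLaurent (p : Polynomial k) :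
    laurentToRatFunc (Polynomial.toLaurent p) = algebraMap (Polynomial k) (RatFunc k) p := by
  induction p using Polynomial.induction_on' with
  | add p q hp hq => simp only [map_add, hp, hq]
  | monomial n r =>
    rw [← Polynomial.C_mul_X_pow_eq_monomial, Polynomial.toLaurent_C_mul_X_pow, map_mul, map_mul,
      laurentToRatFunc_T, map_pow, RatFunc.algebraMap_X, zpow_natCast, RatFunc.algebraMap_C]
    exact congrArg (· * _) (laurentAeval_C _ r)

theorem laurentToRatFunc_injective : Function.Injective (laurentToRatFunc (k := k)) := by
  refine (injective_iff_map_eq_zero _).mpr fun f hf => ?_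
  obtain ⟨n, p, hp⟩ := f.exists_T_pow
  have hp0 : p = 0 := by
    rw [← (RatFunc.algebraMap_injective k).eq_iff, ← laurentToRatFunc_toLaurent, hp, map_mul, hf,
      zero_mul, map_zero]
  rw [hp0, map_zero] at hp
  exact (LaurentPolynomial.isUnit_T (n : ℤ)).mul_left_eq_zero.mp hp.symm

theorem natDegree_le_natDegree_num_div {p q : Polynomial k} (hpq : IsCoprime p q) (hp : p ≠ 0) :
    p.natDegree ≤ (algebraMap _ (RatFunc k) p / algebraMap _ (RatFunc k) q).num.natDegree := by
  rcases eq_or_ne q 0 with rfl | hq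
  · rw [Polynomial.natDegree_eq_zero_of_isUnit (isCoprime_zero_right.mp hpq)]
    exact Nat.zero_le _
  set f := algebraMap _ (RatFunc k) p / algebraMap _ (RatFunc k) q with hf
  have hmul : f.num * q = p * f.denom := (RatFunc.num_mul_eq_mul_denom_iff hq).mpr hf
  have hf0 : f ≠ 0 :=
    div_ne_zero (RatFunc.algebraMap_ne_zero hp) (RatFunc.algebraMap_ne_zero hq)
  exact Polynomial.natDegree_le_of_dvd (hpq.dvd_of_dvd_mul_right (hmul ▸ dvd_mul_right _ _))
    (RatFunc.num_ne_zero hf0)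

theorem exists_toLaurent_eq_mul_T {f : k[T;T⁻¹]} {n : ℕ} (hf : ∀ m < (-n : ℤ), f.coeff m = 0) :
    ∃ p : Polynomial k, Polynomial.toLaurent p = f * T n := by
  refine ⟨∑ m ∈ f.coeff.support, Polynomial.C (f.coeff m) * Polynomial.X ^ (m + n).toNat, ?_⟩
  conv_rhs => rw [← sum_support_C_mul_T f, Finset.sum_mul]
  rw [map_sum]
  refine Finset.sum_congr rfl fun m hm => ?_
  have hmn : 0 ≤ m + n := by
    by_contra h
    exact Finsupp.mem_support_iff.mp hm (hf m (by lia))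
  rw [Polynomial.toLaurent_C_mul_X_pow, Int.toNat_of_nonneg hmn, T_add, mul_assoc]

theorem coeff_toLaurent_natCast (p : Polynomial k) (m : ℕ) :
    (Polynomial.toLaurent p).coeff (m : ℤ) = p.coeff m := by
  rw [LaurentPolynomial.coeff_toLaurent]
  exact Finsupp.mapDomain_apply Nat.cast_injective _ _

theorem two_mul_le_finrank_adjoin_laurentToRatFunc {f : k[T;T⁻¹]} {n : ℕ}
    (hf : ∀ m : ℤ, n < |m| → f.coeff m = 0) (htop : f.coeff n ≠ 0) (hbot : f.coeff (-n) ≠ 0) :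
    2 * n ≤ Module.finrank (IntermediateField.adjoin k {laurentToRatFunc f}) (RatFunc k) := by
  obtain ⟨p, hp⟩ := exists_toLaurent_eq_mul_T (f := f) (n := n) fun m hm =>
    hf m (by rw [lt_abs]; lia)
  have hcoeff (m : ℕ) : p.coeff m = f.coeff (m - n) := by
    rw [← coeff_toLaurent_natCast, hp, coeff_mul_T]
  have hdeg : 2 * n ≤ p.natDegree := Polynomial.le_natDegree_of_ne_zero <| by
    rw [hcoeff]
    convert! htop using 2
    lia
  have hp0 : p.coeff 0 ≠ 0 := by
    rw [hcoeff]
    simpa using hbot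
  have hX : IsCoprime (Polynomial.X : Polynomial k) p :=
    Polynomial.irreducible_X.coprime_iff_not_dvd.mpr (mt Polynomial.X_dvd_iff.mp hp0)
  have hfp : laurentToRatFunc f = algebraMap _ (RatFunc k) p /
      algebraMap (Polynomial k) (RatFunc k) (Polynomial.X ^ n) := by
    rw [eq_div_iff (RatFunc.algebraMap_ne_zero (pow_ne_zero _ Polynomial.X_ne_zero)),
      ← laurentToRatFunc_toLaurent, ← laurentToRatFunc_toLaurent, hp, Polynomial.toLaurent_X_pow,
      map_mul]
  rw [RatFunc.finrank_eq_max_natDegree, hfp]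
  exact le_max_of_le_left <| hdeg.trans <| natDegree_le_natDegree_num_div hX.symm.pow_right fun h =>
    hp0 (by rw [h, Polynomial.coeff_zero])

theorem transcendental_laurentToRatFunc {f : k[T;T⁻¹]} {n : ℤ} (hn : n ≠ 0) (hf : f.coeff n ≠ 0) :
    Transcendental k (laurentToRatFunc f) := by
  refine RatFunc.transcendental_of_ne_C _ fun ⟨c, hc⟩ => hf ?_
  have hfc : f = C c := laurentToRatFunc_injective (hc.trans (laurentAeval_C _ c).symm)
  rw [hfc, LaurentPolynomial.C_apply, if_neg hn]

theorem laurentToRatFunc_mem_of_X_sq_mem {L : IntermediateField k (RatFunc k)}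
    (hX : RatFunc.X ^ 2 ∈ L) {f : k[T;T⁻¹]} (hf : ∀ n, Odd n → f.coeff n = 0) :
    laurentToRatFunc f ∈ L := by
  rw [laurentToRatFunc, laurentAeval_eq_sum]
  refine sum_mem fun n hn => mul_mem (L.algebraMap_mem _) ?_
  have heven : Even n := Int.not_odd_iff_even.mp (mt (hf n) (Finsupp.mem_support_iff.mp hn))
  obtain ⟨j, rfl⟩ := heven.two_dvd
  rw [Units.val_zpow_eq_zpow_val, Units.val_mk0, zpow_mul]
  exact zpow_mem hX j

theorem X_mem_of_X_sq_mem {L : IntermediateField k (RatFunc k)} (hX : RatFunc.X ^ 2 ∈ L)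
    {f : k[T;T⁻¹]} (hf : laurentToRatFunc f ∈ L) {n : ℤ} (hn : Odd n) (hfn : f.coeff n ≠ 0) :
    RatFunc.X ∈ L := by
  let evenPart : k[T;T⁻¹] := .ofCoeff (f.coeff.filter (Even ·))
  let oddPart : k[T;T⁻¹] := .ofCoeff (f.coeff.filter (¬ Even ·))
  have hsplit : evenPart + oddPart = f :=
    LaurentPolynomial.ext fun m => DFunLike.congr_fun (Finsupp.filter_add_filter_not _ _) m
  have hodd : laurentToRatFunc oddPart ∈ L := by
    rw [← add_sub_cancel_left evenPart oddPart, hsplit, map_sub]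
    exact sub_mem hf <| laurentToRatFunc_mem_of_X_sq_mem hX fun m hm =>
      Finsupp.filter_apply_neg _ _ (Int.not_even_iff_odd.mpr hm)
  have hoddT : laurentToRatFunc (oddPart * T (-1)) ∈ L :=
    laurentToRatFunc_mem_of_X_sq_mem hX fun m hm => by
      rw [coeff_mul_T]
      exact Finsupp.filter_apply_neg _ _ (not_not_intro (hm.sub_odd (by decide)))
  have hodd0 : laurentToRatFunc oddPart ≠ 0 := by
    refine (map_ne_zero_iff _ laurentToRatFunc_injective).mpr fun h => hfn ?_
    rw [← Finsupp.filter_apply_pos (¬ Even ·) f.coeff (Int.not_even_iff_odd.mpr hn)]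
    exact congrArg (fun g : k[T;T⁻¹] => g.coeff n) h
  rw [map_mul, laurentToRatFunc_T, zpow_neg_one] at hoddT
  have hX0 : (RatFunc.X : RatFunc k) ≠ 0 := RatFunc.X_ne_zero
  have hdiv : laurentToRatFunc oddPart / (laurentToRatFunc oddPart * RatFunc.X⁻¹) = RatFunc.X := by
    field_simp
  exact hdiv ▸ div_mem hodd hoddT

section SupportCoordinates

variable {R : Type*} [CommRing R]

/-- `x + iy` along the curve with support function `P`, as a Laurent polynomial in `T = exp(iθ)`. -/
noncomputable def isotropicAdd (P : R[T;T⁻¹]) : R[T;T⁻¹] := (P - euler P) * T 1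

/-- `x - iy` along the curve with support function `P`, as a Laurent polynomial in `T = exp(iθ)`. -/
noncomputable def isotropicSub (P : R[T;T⁻¹]) : R[T;T⁻¹] := (P + euler P) * T (-1)

theorem coeff_isotropicAdd (P : R[T;T⁻¹]) (n : ℤ) :
    (isotropicAdd P).coeff n = (2 - n) * P.coeff (n - 1) := by
  rw [isotropicAdd, coeff_mul_T, AddMonoidAlgebra.coeff_sub, Finsupp.sub_apply, coeff_euler]
  push_cast
  ring

theorem coeff_isotropicSub (P : R[T;T⁻¹]) (n : ℤ) :
    (isotropicSub P).coeff n = (2 + n) * P.coeff (n + 1) := by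
  rw [isotropicSub, coeff_mul_T, AddMonoidAlgebra.coeff_add, Finsupp.add_apply, coeff_euler,
    sub_neg_eq_add]
  push_cast
  ring

theorem euler_isotropicSub (P : R[T;T⁻¹]) :
    euler (isotropicSub P) = -(euler (isotropicAdd P) * T (-2)) := by
  ext n
  rw [AddMonoidAlgebra.coeff_neg, Finsupp.neg_apply, coeff_mul_T, coeff_euler, coeff_euler,
    coeff_isotropicAdd, coeff_isotropicSub, show n - -2 - 1 = n + 1 by ring]
  push_cast
  ring

end SupportCoordinates

theorem essFiniteType_ratFunc : Algebra.EssFiniteType k (RatFunc k) :=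
  have := Algebra.EssFiniteType.of_isLocalization (R := Polynomial k) (RatFunc k)
    (nonZeroDivisors (Polynomial k))
  .comp k (Polynomial k) (RatFunc k)

theorem isSeparable_ratFunc_of_transcendental [CharZero k] {x : RatFunc k}
    (hx : Transcendental k x) :
    Algebra.IsSeparable (IntermediateField.adjoin k {x}) (RatFunc k) := by
  have : Algebra.IsAlgebraic (IntermediateField.adjoin k {x}) (RatFunc k) :=
    RatFunc.isAlgebraic_adjoin_simple_X' x <| by
      rintro ⟨c, rfl⟩
      exact hx (isAlgebraic_algebraMap c)
  infer_instance

theorem X_sq_mem_of_isotropic_mem [CharZero k] {L : IntermediateField k (RatFunc k)} {P : k[T;T⁻¹]}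
    (hadd : laurentToRatFunc (isotropicAdd P) ∈ L) (hsub : laurentToRatFunc (isotropicSub P) ∈ L)
    (htr : Transcendental k (laurentToRatFunc (isotropicAdd P - isotropicSub P))) :
    RatFunc.X ^ 2 ∈ L := by
  let D := KaehlerDifferential.D k (RatFunc k)
  set w := laurentToRatFunc (isotropicAdd P) with hw
  set v := laurentToRatFunc (isotropicSub P) with hv
  rw [map_sub, ← hw, ← hv] at htr
  have := isSeparable_ratFunc_of_transcendental htr
  have := essFiniteType_ratFunc (k := k)
  have hD : D (w - v) ≠ 0 := kaehlerDifferential_ne_zero_of_isSeparable htr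
  have hwv : (RatFunc.X ^ 2 : RatFunc k) • D v = -D w := by
    rw [hv, hw, laurentToRatFunc, derivation_laurentAeval, derivation_laurentAeval,
      euler_isotropicSub, ← laurentToRatFunc, map_neg, map_mul, laurentToRatFunc_T, smul_smul,
      ← neg_smul, zpow_neg, zpow_ofNat]
    congr 1
    field_simp [RatFunc.X_ne_zero (K := k)]
  obtain ⟨a, ha, hDw⟩ := exists_mem_derivation_eq_smul D (sub_mem hadd hsub) hadd
    (Algebra.IsSeparable.isSeparable _ w)
  obtain ⟨b, hb, hDv⟩ := exists_mem_derivation_eq_smul D (sub_mem hadd hsub) hsub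
    (Algebra.IsSeparable.isSeparable _ v)
  have hab : a - b = 1 := smul_left_injective (RatFunc k) hD <| by
    change (a - b) • D (w - v) = (1 : RatFunc k) • D (w - v)
    rw [sub_smul, ← hDw, ← hDv, ← map_sub, one_smul]
  have hba : RatFunc.X ^ 2 * b = -a := smul_left_injective (RatFunc k) hD <| by
    simp only [mul_smul, neg_smul, ← hDw, ← hDv, hwv]
  have hb0 : b ≠ 0 := by
    rintro rfl
    rw [mul_zero, zero_eq_neg] at hba
    simp [hba] at hab
  rw [(eq_div_iff hb0).mpr hba]
  exact div_mem (neg_mem ha) hb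

theorem X_mem_of_isotropic_mem [CharZero k] {L : IntermediateField k (RatFunc k)} {P : k[T;T⁻¹]}
    (hadd : laurentToRatFunc (isotropicAdd P) ∈ L) (hsub : laurentToRatFunc (isotropicSub P) ∈ L)
    (htr : Transcendental k (laurentToRatFunc (isotropicAdd P - isotropicSub P)))
    {m : ℤ} (hm : Even m) (hPm : P.coeff m ≠ 0) : RatFunc.X ∈ L := by
  refine X_mem_of_X_sq_mem (X_sq_mem_of_isotropic_mem hadd hsub htr) hadd hm.add_one ?_
  rw [coeff_isotropicAdd, add_sub_cancel_right]
  refine mul_ne_zero ?_ hPm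
  rw [sub_ne_zero, Ne, ← Int.cast_ofNat, Int.cast_inj]
  rintro h
  obtain ⟨j, rfl⟩ := hm
  lia

end Laurent

section SupportCurve

open LaurentPolynomial

/-- Coordinates `(x, y)` of the complexified support curve, recovered from `x + iy` and `x - iy`. -/
noncomputable def supportCoords (P : ℂ[T;T⁻¹]) : Fin 2 → ℂ[T;T⁻¹] :=
  ![C (1 / 2) * (isotropicAdd P + isotropicSub P),
    C (1 / (2 * Complex.I)) * (isotropicAdd P - isotropicSub P)]

theorem supportCoords_zero (P : ℂ[T;T⁻¹]) :
    supportCoords P 0 = C (1 / 2) * (isotropicAdd P + isotropicSub P) := rfl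

theorem supportCoords_one (P : ℂ[T;T⁻¹]) :
    supportCoords P 1 = C (1 / (2 * Complex.I)) * (isotropicAdd P - isotropicSub P) := rfl

theorem isotropicAdd_eq (P : ℂ[T;T⁻¹]) :
    isotropicAdd P = supportCoords P 0 + C Complex.I * supportCoords P 1 := by
  rw [supportCoords_zero, supportCoords_one, ← mul_assoc, ← map_mul,
    show Complex.I * (1 / (2 * Complex.I)) = 1 / 2 by field_simp, ← mul_add, add_add_sub_cancel,
    ← two_mul, ← mul_assoc, ← map_ofNat C 2, ← map_mul, one_div_mul_cancel two_ne_zero, map_one,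
    one_mul]

theorem isotropicSub_eq (P : ℂ[T;T⁻¹]) :
    isotropicSub P = supportCoords P 0 - C Complex.I * supportCoords P 1 := by
  rw [supportCoords_zero, supportCoords_one, ← mul_assoc, ← map_mul,
    show Complex.I * (1 / (2 * Complex.I)) = 1 / 2 by field_simp, ← mul_sub, add_sub_sub_cancel,
    ← two_mul, ← mul_assoc, ← map_ofNat C 2, ← map_mul, one_div_mul_cancel two_ne_zero, map_one,
    one_mul]

variable {P : ℂ[T;T⁻¹]} {n : ℕ}

theorem coeff_supportCoords_one (P : ℂ[T;T⁻¹]) (m : ℤ) :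
    (supportCoords P 1).coeff m =
      1 / (2 * Complex.I) * ((2 - m) * P.coeff (m - 1) - (2 + m) * P.coeff (m + 1)) := by
  rw [supportCoords_one, ← LaurentPolynomial.smul_eq_C_mul, AddMonoidAlgebra.coeff_smul,
    Finsupp.smul_apply, AddMonoidAlgebra.coeff_sub, Finsupp.sub_apply, coeff_isotropicAdd,
    coeff_isotropicSub, smul_eq_mul]

theorem coeff_supportCoords_one_top (hP : ∀ m : ℤ, n < |m| → P.coeff m = 0) :
    (supportCoords P 1).coeff (n + 1 : ℕ) = 1 / (2 * Complex.I) * ((1 - n) * P.coeff n) := by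
  rw [coeff_supportCoords_one, hP ((n + 1 : ℕ) + 1) (by rw [lt_abs]; lia), mul_zero, sub_zero]
  push_cast
  ring_nf

theorem coeff_supportCoords_one_bot (hP : ∀ m : ℤ, n < |m| → P.coeff m = 0) :
    (supportCoords P 1).coeff (-(n + 1 : ℕ)) =
      -(1 / (2 * Complex.I) * ((1 - n) * P.coeff (-n))) := by
  rw [coeff_supportCoords_one, hP (-(n + 1 : ℕ) - 1) (by rw [lt_abs]; lia), mul_zero, zero_sub]
  push_cast
  ring_nf

theorem coeff_supportCoords_one_eq_zero (hP : ∀ m : ℤ, n < |m| → P.coeff m = 0) {m : ℤ}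
    (hm : (n + 1 : ℕ) < |m|) : (supportCoords P 1).coeff m = 0 := by
  rw [lt_abs] at hm
  rw [coeff_supportCoords_one, hP (m - 1) (by rw [lt_abs]; lia), hP (m + 1) (by rw [lt_abs]; lia),
    mul_zero, mul_zero, sub_zero, mul_zero]

theorem adjoin_laurentToRatFunc_supportCoords
    (htr : Transcendental ℂ (laurentToRatFunc (supportCoords P 1))) {m : ℤ} (hm : Even m)
    (hPm : P.coeff m ≠ 0) :
    IntermediateField.adjoin ℂ (Set.range (laurentToRatFunc ∘ supportCoords P)) = ⊤ := by
  set L := IntermediateField.adjoin ℂ (Set.range (laurentToRatFunc ∘ supportCoords P))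
  have hcoord (i : Fin 2) : laurentToRatFunc (supportCoords P i) ∈ L :=
    IntermediateField.subset_adjoin ℂ _ ⟨i, rfl⟩
  have hIy : laurentToRatFunc (C Complex.I * supportCoords P 1) ∈ L := by
    rw [← LaurentPolynomial.smul_eq_C_mul, map_smul]
    exact L.smul_mem (hcoord 1)
  have hX : RatFunc.X ∈ L := by
    refine X_mem_of_isotropic_mem ?_ ?_ ?_ hm hPm
    · rw [isotropicAdd_eq, map_add]
      exact add_mem (hcoord 0) hIy
    · rw [isotropicSub_eq, map_sub]
      exact sub_mem (hcoord 0) hIy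
    · refine fun halg => htr ?_
      rw [supportCoords_one, ← LaurentPolynomial.smul_eq_C_mul, map_smul]
      exact halg.smul _
  rw [eq_top_iff, ← RatFunc.adjoin_X, IntermediateField.adjoin_simple_le_iff]
  exact hX

theorem two_mul_succ_le_degreeOf_of_aeval_supportCoords_eq_zero (hn : n ≠ 1)
    (hP : ∀ m : ℤ, n < |m| → P.coeff m = 0) (htop : P.coeff n ≠ 0) (hbot : P.coeff (-n) ≠ 0)
    {m : ℤ} (hm : Even m) (hPm : P.coeff m ≠ 0) {G : MvPolynomial (Fin 2) ℂ} (hG : G ≠ 0)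
    (hGP : MvPolynomial.aeval (supportCoords P) G = 0) : 2 * (n + 1) ≤ G.degreeOf 0 := by
  have hn1 : (1 - n : ℂ) ≠ 0 := sub_ne_zero.mpr (by exact_mod_cast hn.symm)
  have hI : 1 / (2 * Complex.I) ≠ 0 := by simp
  have hy_top : (supportCoords P 1).coeff (n + 1 : ℕ) ≠ 0 := by
    rw [coeff_supportCoords_one_top hP]
    exact mul_ne_zero hI (mul_ne_zero hn1 htop)
  have hy_bot : (supportCoords P 1).coeff (-(n + 1 : ℕ)) ≠ 0 := by
    rw [coeff_supportCoords_one_bot hP]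
    exact neg_ne_zero.mpr (mul_ne_zero hI (mul_ne_zero hn1 hbot))
  have htr : Transcendental ℂ (laurentToRatFunc (supportCoords P 1)) :=
    transcendental_laurentToRatFunc (by lia) hy_top
  have htail : Fin.tail (laurentToRatFunc ∘ supportCoords P) =
      fun _ => laurentToRatFunc (supportCoords P 1) := funext fun i => by
    rw [Subsingleton.elim i 0]; rfl
  have hroot : MvPolynomial.aeval (laurentToRatFunc ∘ supportCoords P) G = 0 := by
    rw [← map_zero laurentToRatFunc, ← hGP]
    exact (MvPolynomial.comp_aeval_apply _ _ G).symm
  calc 2 * (n + 1)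
      ≤ Module.finrank (IntermediateField.adjoin ℂ {laurentToRatFunc (supportCoords P 1)})
          (RatFunc ℂ) :=
        two_mul_le_finrank_adjoin_laurentToRatFunc (fun m => coeff_supportCoords_one_eq_zero hP)
          hy_top hy_bot
    _ = Module.finrank (IntermediateField.adjoin ℂ
          (Set.range (Fin.tail (laurentToRatFunc ∘ supportCoords P)))) (RatFunc ℂ) := by
        rw [htail, Set.range_const]
    _ ≤ G.degreeOf 0 := by
        refine finrank_adjoin_tail_le_degreeOf ?_
          (adjoin_laurentToRatFunc_supportCoords htr hm hPm) hG hroot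
        rw [htail]
        exact algebraicIndependent_unique_type_iff.mpr htr

/-- Evaluation at `T = exp(iθ)`, which turns `∑ cₙ Tⁿ` into the trigonometric polynomial
`∑ cₙ exp(inθ)`. -/
noncomputable def trigEval (θ : ℝ) : ℂ[T;T⁻¹] →ₐ[ℂ] ℂ :=
  laurentAeval (Circle.toUnits (Circle.exp θ))

theorem trigEval_C (θ : ℝ) (c : ℂ) : trigEval θ (C c) = c := laurentAeval_C _ c

theorem trigEval_T (θ : ℝ) (m : ℤ) : trigEval θ (T m) = Complex.exp (m * (θ * Complex.I)) := by
  rw [trigEval, laurentAeval_T, Units.val_zpow_eq_zpow_val, Complex.exp_int_mul]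
  rfl

theorem hasDerivAt_trigEval (P : ℂ[T;T⁻¹]) (θ : ℝ) :
    HasDerivAt (fun θ => trigEval θ P) (Complex.I * trigEval θ (euler P)) θ := by
  induction P using LaurentPolynomial.induction_on' with
  | add P Q hP hQ =>
    simp only [map_add, mul_add]
    exact hP.add hQ
  | C_mul_T m c =>
    rw [euler_C_mul_T]
    simp only [map_mul, trigEval_C, trigEval_T]
    have hlin : HasDerivAt (fun θ : ℝ => (m : ℂ) * (θ * Complex.I)) (m * Complex.I) θ := by
      simpa using ((hasDerivAt_id θ).ofReal_comp.mul_const Complex.I).const_mul (m : ℂ)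
    exact (hlin.cexp.const_mul c).congr_deriv (by ring)

theorem eq_zero_of_trigEval_eq_zero (hP : ∀ θ ∈ Set.Icc (-π) π, trigEval θ P = 0) : P = 0 := by
  obtain ⟨m, q, hq⟩ := P.exists_T_pow
  have hroot (θ : ℝ) (hθ : θ ∈ Set.Icc (-π) π) : q.IsRoot (Circle.exp θ) := by
    have heval : trigEval θ (Polynomial.toLaurent q) = q.eval (Circle.exp θ : ℂ) := by
      exact LaurentPolynomial.eval₂_toLaurent _ _ _
    rw [Polynomial.IsRoot.def, ← heval, hq, map_mul, hP θ hθ, zero_mul]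
  have hinj : Set.InjOn (fun θ => (Circle.exp θ : ℂ)) (Set.Ioc (-π) π) :=
    Circle.coe_injective.comp_injOn Circle.invOn_arg_exp.1.injOn
  have hq0 : q = 0 := Polynomial.eq_zero_of_infinite_isRoot q <|
    ((Set.Ioc_infinite (by linarith [pi_pos])).image hinj).mono <| by
      rintro _ ⟨θ, hθ, rfl⟩
      exact hroot θ (Set.Ioc_subset_Icc_self hθ)
  rw [hq0, map_zero] at hq
  exact (LaurentPolynomial.isUnit_T (m : ℤ)).mul_left_eq_zero.mp hq.symm

variable {p : ℝ → ℝ}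

theorem ofReal_deriv_eq_trigEval (hp : ∀ θ, (p θ : ℂ) = trigEval θ P) (θ : ℝ) :
    ((deriv p θ : ℝ) : ℂ) = Complex.I * trigEval θ (euler P) := by
  have hcomplex : HasDerivAt (fun θ => (p θ : ℂ)) (Complex.I * trigEval θ (euler P)) θ :=
    (hasDerivAt_trigEval P θ).congr_of_eventuallyEq (.of_forall hp)
  have hreal : DifferentiableAt ℝ p θ :=
    (Complex.reCLM.differentiableAt.comp θ hcomplex.differentiableAt :)
  exact hreal.hasDerivAt.ofReal_comp.unique hcomplex

theorem trigEval_isotropicAdd (hp : ∀ θ, (p θ : ℂ) = trigEval θ P) (θ : ℝ) :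
    trigEval θ (isotropicAdd P) = supportParam p θ 0 + Complex.I * supportParam p θ 1 := by
  have hd := ofReal_deriv_eq_trigEval hp θ
  simp only [isotropicAdd, map_mul, map_sub, ← hp, trigEval_T, supportParam, PiLp.toLp_apply,
    Matrix.cons_val_zero, Matrix.cons_val_one]
  push_cast
  rw [one_mul, Complex.exp_mul_I]
  linear_combination -Complex.I * (Complex.cos θ + Complex.sin θ * Complex.I) * hd +
    (Complex.sin θ * (deriv p θ : ℝ) -
      trigEval θ (euler P) * (Complex.cos θ + Complex.sin θ * Complex.I)) * Complex.I_sq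

theorem trigEval_isotropicSub (hp : ∀ θ, (p θ : ℂ) = trigEval θ P) (θ : ℝ) :
    trigEval θ (isotropicSub P) = supportParam p θ 0 - Complex.I * supportParam p θ 1 := by
  have hd := ofReal_deriv_eq_trigEval hp θ
  simp only [isotropicSub, map_mul, map_add, ← hp, trigEval_T, supportParam, PiLp.toLp_apply,
    Matrix.cons_val_zero, Matrix.cons_val_one]
  push_cast
  rw [neg_one_mul, ← neg_mul, Complex.exp_mul_I, Complex.cos_neg, Complex.sin_neg]
  linear_combination Complex.I * (Complex.cos θ - Complex.sin θ * Complex.I) * hd +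
    (Complex.sin θ * (deriv p θ : ℝ) +
      trigEval θ (euler P) * (Complex.cos θ - Complex.sin θ * Complex.I)) * Complex.I_sq

theorem trigEval_supportCoords (hp : ∀ θ, (p θ : ℂ) = trigEval θ P) (θ : ℝ) (i : Fin 2) :
    trigEval θ (supportCoords P i) = supportParam p θ i := by
  fin_cases i
  · change trigEval θ (supportCoords P 0) = supportParam p θ 0
    rw [supportCoords_zero, map_mul, map_add, trigEval_C, trigEval_isotropicAdd hp,
      trigEval_isotropicSub hp]
    ring
  · change trigEval θ (supportCoords P 1) = supportParam p θ 1
    rw [supportCoords_one, map_mul, map_sub, trigEval_C, trigEval_isotropicAdd hp,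
      trigEval_isotropicSub hp]
    field_simp
    ring

theorem vanishesOn_supportCurve_iff (hp : ∀ θ, (p θ : ℂ) = trigEval θ P)
    (g : MvPolynomial (Fin 2) ℝ) :
    VanishesOn g (supportCurve p) ↔ MvPolynomial.aeval (supportCoords P) g = 0 := by
  have heval (θ : ℝ) : trigEval θ (MvPolynomial.aeval (supportCoords P) g) =
      (MvPolynomial.eval (fun i => supportParam p θ i) g : ℝ) := by
    have hcomp := MvPolynomial.comp_aeval_apply (f := supportCoords P)
      ((trigEval θ).restrictScalars ℝ) g
    simp only [AlgHom.coe_restrictScalars', trigEval_supportCoords hp] at hcomp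
    rw [hcomp]
    exact (MvPolynomial.aeval_algebraMap_apply ℂ (fun i => supportParam p θ i) g).trans
      (by rw [MvPolynomial.aeval_eq_eval]; rfl)
  constructor
  · intro h
    refine eq_zero_of_trigEval_eq_zero fun θ hθ => ?_
    rw [heval, h _ ⟨θ, hθ, rfl⟩, Complex.ofReal_zero]
  · rintro h _ ⟨θ, -, rfl⟩
    rw [← Complex.ofReal_eq_zero, ← heval, h, map_zero]

theorem coeff_neg_eq_conj_of_ofReal_eq_trigEval (hp : ∀ θ, (p θ : ℂ) = trigEval θ P) (m : ℤ) :
    P.coeff (-m) = starRingEnd ℂ (P.coeff m) := by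
  let conjReflect (Q : ℂ[T;T⁻¹]) : ℂ[T;T⁻¹] :=
    AddMonoidAlgebra.mapRingHom ℤ (starRingEnd ℂ) (invert Q)
  have htrig (θ : ℝ) (Q : ℂ[T;T⁻¹]) :
      trigEval θ (conjReflect Q) = starRingEnd ℂ (trigEval θ Q) := by
    induction Q using LaurentPolynomial.induction_on' with
    | add Q R hQ hR =>
      simp only [conjReflect, map_add] at hQ hR ⊢
      rw [hQ, hR]
    | C_mul_T n c =>
      have hmonomial : conjReflect (C c * T n) = C (starRingEnd ℂ c) * T (-n) := by
        simp only [conjReflect, map_mul invert, invert_C, invert_T]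
        rw [← LaurentPolynomial.single_eq_C_mul_T, AddMonoidAlgebra.mapRingHom_single,
          LaurentPolynomial.single_eq_C_mul_T]
      rw [hmonomial]
      simp only [map_mul, trigEval_C, trigEval_T, ← Complex.exp_conj, Complex.conj_I,
        Complex.conj_ofReal, map_intCast, Int.cast_neg, mul_neg, neg_mul]
  have hfixed : conjReflect P = P := sub_eq_zero.mp <| eq_zero_of_trigEval_eq_zero fun θ _ => by
    rw [map_sub, htrig, ← hp, Complex.conj_ofReal, sub_self]
  conv_lhs => rw [← hfixed]
  rw [AddMonoidAlgebra.coeff_mapRingHom, invert_apply, neg_neg]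

theorem isotropicAdd_eq_of_coeff_eq_zero (hP : ∀ m : ℤ, 1 < |m| → P.coeff m = 0) :
    isotropicAdd P = C (2 * P.coeff (-1)) + C (P.coeff 0) * T 1 := by
  ext m
  rw [coeff_isotropicAdd, AddMonoidAlgebra.coeff_add, Finsupp.add_apply, coeff_mul_T,
    LaurentPolynomial.C_apply, LaurentPolynomial.C_apply]
  by_cases h : 1 < |m - 1|
  · rw [hP _ h, if_neg, if_neg] <;> grind
  · obtain rfl | rfl | rfl : m = 0 ∨ m = 1 ∨ m = 2 := by grind
    all_goals norm_num

theorem isCircle_supportCurve (hp : ∀ θ, (p θ : ℂ) = trigEval θ P)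
    (hP : ∀ m : ℤ, 1 < |m| → P.coeff m = 0) : IsCircle (supportCurve p) := by
  set r := (P.coeff 0).re
  have hr : P.coeff 0 = r :=
    (Complex.conj_eq_iff_re.mp (coeff_neg_eq_conj_of_ofReal_eq_trigEval hp 0).symm).symm
  have hparam (θ : ℝ) : supportParam p θ =
      Complex.orthonormalBasisOneI.repr (circleMap (2 * P.coeff (-1)) r θ) := by
    have hcircle : circleMap (2 * P.coeff (-1)) r θ =
        supportParam p θ 0 + Complex.I * supportParam p θ 1 := by
      rw [← trigEval_isotropicAdd hp, isotropicAdd_eq_of_coeff_eq_zero hP, hr, map_add,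
        map_mul (trigEval θ), trigEval_C, trigEval_C, trigEval_T, Int.cast_one, one_mul, circleMap]
    ext i
    rw [hcircle]
    fin_cases i <;> simp
  refine ⟨Complex.orthonormalBasisOneI.repr (2 * P.coeff (-1)), |r|, ?_⟩
  rw [← LinearIsometryEquiv.image_sphere, ← range_circleMap,
    ← (periodic_circleMap _ r).image_Icc Real.two_pi_pos (-π), Set.image_image, supportCurve,
    show -π + 2 * π = π by ring]
  exact Set.image_congr fun θ _ => hparam θ

theorem two_mul_succ_le_degreeOf_of_vanishesOn (hp : ∀ θ, (p θ : ℂ) = trigEval θ P) (hn : n ≠ 1)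
    (hP : ∀ m : ℤ, n < |m| → P.coeff m = 0) (htop : P.coeff n ≠ 0) {m : ℤ} (hm : Even m)
    (hPm : P.coeff m ≠ 0) {g : MvPolynomial (Fin 2) ℝ} (hg : g ≠ 0)
    (hgp : VanishesOn g (supportCurve p)) : 2 * (n + 1) ≤ g.degreeOf 0 := by
  have hinj : Function.Injective (algebraMap ℝ ℂ) := (algebraMap ℝ ℂ).injective
  have hbot : P.coeff (-n) ≠ 0 := by
    rwa [coeff_neg_eq_conj_of_ofReal_eq_trigEval hp, map_ne_zero]
  have hdeg : (MvPolynomial.map (algebraMap ℝ ℂ) g).degreeOf 0 = g.degreeOf 0 := by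
    rw [MvPolynomial.degreeOf_eq_sup, MvPolynomial.degreeOf_eq_sup,
      MvPolynomial.support_map_of_injective _ hinj]
  rw [← hdeg]
  refine two_mul_succ_le_degreeOf_of_aeval_supportCoords_eq_zero hn hP htop hbot hm hPm
    ((MvPolynomial.map_injective _ hinj).ne_iff' (map_zero _) |>.mpr hg) ?_
  rw [MvPolynomial.aeval_map_algebraMap]
  exact (vanishesOn_supportCurve_iff hp g).mp hgp

/-- The trigonometric polynomials `α/2 + ∑ (aₖ cos (2k+1)θ + bₖ sin (2k+1)θ)` that serve as support
functions, without the conditions `0 < α` and `p + p'' ≥ 0`. -/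
def IsOddTrigPolynomial (α : ℝ) (p : ℝ → ℝ) : Prop :=
  ∃ (N : ℕ) (a b : ℕ → ℝ), ∀ θ : ℝ,
    p θ = α / 2 + ∑ k ∈ Finset.range (N + 1),
      (a k * cos ((2 * (k : ℝ) + 1) * θ) + b k * sin ((2 * (k : ℝ) + 1) * θ))

theorem trigEval_harmonic (a b θ : ℝ) (m : ℤ) :
    trigEval θ (C ((a - b * Complex.I) / 2) * T m + C ((a + b * Complex.I) / 2) * T (-m)) =
      (a * cos (m * θ) + b * sin (m * θ) : ℝ) := by
  simp only [map_add, map_mul, trigEval_C, trigEval_T]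
  push_cast
  rw [← mul_assoc, ← mul_assoc, Complex.exp_mul_I, Complex.exp_mul_I, neg_mul, Complex.cos_neg,
    Complex.sin_neg]
  linear_combination -b * Complex.sin (m * θ) * Complex.I_sq

theorem IsOddTrigPolynomial.exists_laurent {α : ℝ} (h : IsOddTrigPolynomial α p) :
    ∃ P : ℂ[T;T⁻¹], (∀ θ, (p θ : ℂ) = trigEval θ P) ∧ P.coeff 0 = (α / 2 : ℝ) ∧
      ∀ m : ℤ, Even m → m ≠ 0 → P.coeff m = 0 := by
  obtain ⟨N, a, b, hp⟩ := h
  let Q : ℂ[T;T⁻¹] := ∑ k ∈ Finset.range (N + 1),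
    (C ((a k - b k * Complex.I) / 2) * T (2 * k + 1) +
      C ((a k + b k * Complex.I) / 2) * T (-(2 * k + 1)))
  have hQ (m : ℤ) (hm : Even m) : Q.coeff m = 0 := by
    rw [AddMonoidAlgebra.coeff_sum, Finsupp.finsetSum_apply]
    refine Finset.sum_eq_zero fun k _ => ?_
    rw [AddMonoidAlgebra.coeff_add, Finsupp.add_apply, coeff_mul_T, coeff_mul_T,
      LaurentPolynomial.C_apply, LaurentPolynomial.C_apply, if_neg, if_neg, add_zero] <;> grind
  refine ⟨C ((α / 2 : ℝ) : ℂ) + Q, fun θ => ?_, ?_, fun m hm hm0 => ?_⟩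
  · rw [hp, map_add, trigEval_C, map_sum, Complex.ofReal_add, Complex.ofReal_sum]
    congr 1
    refine Finset.sum_congr rfl fun k _ => ?_
    rw [trigEval_harmonic]
    push_cast
    rfl
  · rw [AddMonoidAlgebra.coeff_add, Finsupp.add_apply, hQ 0 Even.zero, add_zero,
      LaurentPolynomial.C_apply, if_pos rfl]
  · rw [AddMonoidAlgebra.coeff_add, Finsupp.add_apply, hQ m hm, add_zero,
      LaurentPolynomial.C_apply, if_neg hm0]

theorem IsOddTrigPolynomial.eight_le_degreeOf {α : ℝ} (h : IsOddTrigPolynomial α p) (hα : α ≠ 0)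
    (hcirc : ¬ IsCircle (supportCurve p)) {g : MvPolynomial (Fin 2) ℝ} (hg : g ≠ 0)
    (hgp : VanishesOn g (supportCurve p)) : 8 ≤ g.degreeOf 0 := by
  obtain ⟨P, hp, hP0, heven⟩ := h.exists_laurent
  have hP0_ne : P.coeff 0 ≠ 0 := by
    rw [hP0]
    exact_mod_cast div_ne_zero hα two_ne_zero
  obtain ⟨l, hl, hmax⟩ := Finset.exists_max_image P.coeff.support Int.natAbs
    ⟨0, Finsupp.mem_support_iff.mpr hP0_ne⟩
  have hl_ne : P.coeff l ≠ 0 := Finsupp.mem_support_iff.mp hl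
  have hbound (m : ℤ) (hm : l.natAbs < |m|) : P.coeff m = 0 := by
    by_contra hm0
    rw [Int.abs_eq_natAbs, Nat.cast_lt] at hm
    exact hm.not_ge (hmax m (Finsupp.mem_support_iff.mpr hm0))
  have htop : P.coeff l.natAbs ≠ 0 := by
    rcases Int.natAbs_eq l with hl' | hl'
    · rwa [← hl']
    · rwa [← neg_eq_iff_eq_neg.mpr hl', coeff_neg_eq_conj_of_ofReal_eq_trigEval hp,
        map_ne_zero]
  have hone_lt : 1 < l.natAbs := by
    by_contra! hle
    exact hcirc (isCircle_supportCurve hp fun m hm => hbound m (by lia))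
  obtain ⟨j, hj⟩ : Odd l := by
    by_contra hnot
    exact hl_ne (heven l (Int.not_odd_iff_even.mp hnot)
      (Int.natAbs_pos.mp (zero_lt_one.trans hone_lt)))
  calc 8 ≤ 2 * (l.natAbs + 1) := by lia
    _ ≤ g.degreeOf 0 := two_mul_succ_le_degreeOf_of_vanishesOn hp hone_lt.ne' hbound htop Even.zero
        hP0_ne hg hgp

theorem ker_eq_span_singleton_of_monic {R A : Type*} [CommRing R] [CommRing A]
    (φ : Polynomial R →+* A) {f : Polynomial R} (hf : f.Monic) (hφf : φ f = 0)
    (hmin : ∀ g, g ≠ 0 → φ g = 0 → f.natDegree ≤ g.natDegree) :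
    RingHom.ker φ = Ideal.span {f} := by
  refine le_antisymm (fun g hg => ?_) ((Ideal.span_singleton_le_iff_mem _).mpr hφf)
  rw [Ideal.mem_span_singleton, ← Polynomial.modByMonic_eq_zero_iff_dvd hf]
  nontriviality R
  by_contra hrem
  refine (hmin _ hrem ?_).not_gt (Polynomial.natDegree_modByMonic_lt g hf ?_)
  · have hdiv := congrArg φ (Polynomial.modByMonic_add_div g f)
    rwa [map_add, map_mul, hφf, zero_mul, add_zero, RingHom.mem_ker.mp hg] at hdiv
  · rintro rfl
    exact hrem (Polynomial.modByMonic_one g)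

theorem isDefiningPolynomial_of_monic (hp : ∀ θ, (p θ : ℂ) = trigEval θ P)
    {f : MvPolynomial (Fin 2) ℝ} (hf : (MvPolynomial.finSuccEquiv ℝ 1 f).Monic)
    (hfp : VanishesOn f (supportCurve p))
    (hmin : ∀ g, g ≠ 0 → VanishesOn g (supportCurve p) → f.degreeOf 0 ≤ g.degreeOf 0) :
    IsDefiningPolynomial f (supportCurve p) := by
  let e := MvPolynomial.finSuccEquiv ℝ 1
  let φ := (MvPolynomial.aeval (R := ℝ) (supportCoords P)).toRingHom.comp
    e.symm.toRingEquiv.toRingHom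
  have hφ (g : MvPolynomial (Fin 2) ℝ) : φ (e g) = 0 ↔ VanishesOn g (supportCurve p) := by
    rw [vanishesOn_supportCurve_iff hp]
    exact iff_of_eq (congrArg (MvPolynomial.aeval (supportCoords P) · = 0) (e.symm_apply_apply g))
  have hker : RingHom.ker φ = Ideal.span {e f} := by
    refine ker_eq_span_singleton_of_monic φ hf ((hφ f).mpr hfp) fun G hG hφG => ?_
    obtain ⟨g, rfl⟩ := e.surjective G
    rw [MvPolynomial.natDegree_finSuccEquiv, MvPolynomial.natDegree_finSuccEquiv]
    exact hmin g (e.map_ne_zero_iff.mp hG) ((hφ g).mp hφG)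
  have hprime : Prime (e f) := by
    rw [← Ideal.span_singleton_prime hf.ne_zero, ← hker]
    exact RingHom.ker_isPrime φ
  refine ⟨((MulEquiv.prime_iff e).mp hprime).irreducible, fun g => ?_⟩
  rw [← hφ, ← RingHom.mem_ker, hker, Ideal.mem_span_singleton, map_dvd_iff]

/-- The polynomial `|z - c|² - r²` of the circle with centre `c` and radius `r`. -/
noncomputable def circlePolynomial (c : EuclideanSpace ℝ (Fin 2)) (r : ℝ) :
    MvPolynomial (Fin 2) ℝ :=
  (MvPolynomial.X 0 - MvPolynomial.C (c 0)) ^ 2 + (MvPolynomial.X 1 - MvPolynomial.C (c 1)) ^ 2 -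
    MvPolynomial.C (r ^ 2)

theorem eval_circlePolynomial (c z : EuclideanSpace ℝ (Fin 2)) (r : ℝ) :
    MvPolynomial.eval (fun i => z i) (circlePolynomial c r) = dist z c ^ 2 - r ^ 2 := by
  simp [circlePolynomial, EuclideanSpace.dist_sq_eq, Fin.sum_univ_two, Real.dist_eq]

theorem vanishesOn_circlePolynomial (c : EuclideanSpace ℝ (Fin 2)) (r : ℝ) :
    VanishesOn (circlePolynomial c r) (Metric.sphere c r) := fun z hz => by
  rw [eval_circlePolynomial, Metric.mem_sphere.mp hz, sub_self]

theorem circlePolynomial_ne_zero (c : EuclideanSpace ℝ (Fin 2)) (r : ℝ) :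
    circlePolynomial c r ≠ 0 := fun h => by
  have heval := eval_circlePolynomial c (EuclideanSpace.single 0 (|r| + 1) + c) r
  rw [h, map_zero, dist_eq_norm, add_sub_cancel_right, PiLp.norm_single, Real.norm_eq_abs, sq_abs,
    ← sq_abs r] at heval
  linarith [abs_nonneg r]

theorem totalDegree_circlePolynomial_le (c : EuclideanSpace ℝ (Fin 2)) (r : ℝ) :
    (circlePolynomial c r).totalDegree ≤ 2 := by
  have hsq (i : Fin 2) :
      ((MvPolynomial.X i - MvPolynomial.C (c i)) ^ 2 : MvPolynomial (Fin 2) ℝ).totalDegree ≤ 2 :=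
    (MvPolynomial.totalDegree_pow _ _).trans <| Nat.mul_le_mul_left 2 <|
      (MvPolynomial.totalDegree_sub_C_le _ _).trans (MvPolynomial.totalDegree_X i).le
  exact (MvPolynomial.totalDegree_sub_C_le _ _).trans <|
    (MvPolynomial.totalDegree_add _ _).trans (max_le (hsq 0) (hsq 1))

theorem not_isCircle_supportCurve (hp : ∀ θ, (p θ : ℂ) = trigEval θ P) (hn : 1 < n)
    (hP : ∀ m : ℤ, n < |m| → P.coeff m = 0) (htop : P.coeff n ≠ 0) {m : ℤ} (hm : Even m)
    (hPm : P.coeff m ≠ 0) : ¬ IsCircle (supportCurve p) := by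
  rintro ⟨c, r, h⟩
  have hlower := two_mul_succ_le_degreeOf_of_vanishesOn hp hn.ne' hP htop hm hPm
    (circlePolynomial_ne_zero c r) (h ▸ vanishesOn_circlePolynomial c r)
  have hupper := ((circlePolynomial c r).degreeOf_le_totalDegree 0).trans
    (totalDegree_circlePolynomial_le c r)
  lia

end SupportCurve

section Example

theorem deriv_exampleSupport (θ : ℝ) : deriv exampleSupport θ = -(3 / 16) * sin (3 * θ) := by
  have h : HasDerivAt (fun θ : ℝ => 3 * θ) 3 θ :=
    ((hasDerivAt_id θ).const_mul 3).congr_deriv (mul_one _)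
  exact (((h.cos.const_mul (1 / 16)).const_add (1 / 2)).congr_deriv (by ring)).deriv

theorem deriv_deriv_exampleSupport (θ : ℝ) :
    deriv (deriv exampleSupport) θ = -(9 / 16) * cos (3 * θ) := by
  rw [funext deriv_exampleSupport]
  have h : HasDerivAt (fun θ : ℝ => 3 * θ) 3 θ :=
    ((hasDerivAt_id θ).const_mul 3).congr_deriv (mul_one _)
  exact ((h.sin.const_mul (-(3 / 16))).congr_deriv (by ring)).deriv

theorem isConstantWidthSupport_exampleSupport : IsConstantWidthSupport 1 exampleSupport := by
  refine ⟨one_pos, ⟨1, Pi.single 1 (1 / 16), 0, fun θ => ?_⟩, fun θ => ?_⟩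
  · rw [exampleSupport, Finset.sum_range_succ, Finset.sum_range_one]
    norm_num
  · rw [deriv_deriv_exampleSupport, exampleSupport]
    linarith [cos_le_one (3 * θ)]

section ExampleLaurent

open LaurentPolynomial

/-- The Laurent polynomial whose values at `T = exp(iθ)` are `exampleSupport θ`. -/
noncomputable def exampleLaurent : ℂ[T;T⁻¹] := C (1 / 2) + C (1 / 32) * T 3 + C (1 / 32) * T (-3)

theorem ofReal_exampleSupport (θ : ℝ) : (exampleSupport θ : ℂ) = trigEval θ exampleLaurent := by
  rw [exampleLaurent, map_add, map_add, map_mul (trigEval θ), map_mul (trigEval θ)]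
  simp only [trigEval_C, trigEval_T, exampleSupport]
  push_cast
  rw [Complex.cos, neg_mul, neg_mul, mul_assoc]
  ring

theorem coeff_exampleLaurent (m : ℤ) : exampleLaurent.coeff m =
    if m = 0 then 1 / 2 else if |m| = 3 then 1 / 32 else 0 := by
  rw [exampleLaurent, AddMonoidAlgebra.coeff_add, AddMonoidAlgebra.coeff_add, Finsupp.add_apply,
    Finsupp.add_apply, coeff_mul_T, coeff_mul_T, LaurentPolynomial.C_apply,
    LaurentPolynomial.C_apply, LaurentPolynomial.C_apply]
  grind

theorem coeff_exampleLaurent_eq_zero (m : ℤ) (hm : (3 : ℕ) < |m|) : exampleLaurent.coeff m = 0 := by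
  rw [coeff_exampleLaurent, if_neg (by rintro rfl; simp at hm), if_neg (by lia)]

theorem coeff_exampleLaurent_three_ne_zero : exampleLaurent.coeff (3 : ℕ) ≠ 0 := by
  norm_num [coeff_exampleLaurent]

theorem coeff_exampleLaurent_zero_ne_zero : exampleLaurent.coeff 0 ≠ 0 := by
  norm_num [coeff_exampleLaurent]

end ExampleLaurent

theorem not_isCircle_supportCurve_exampleSupport : ¬ IsCircle (supportCurve exampleSupport) :=
  not_isCircle_supportCurve ofReal_exampleSupport (by norm_num) coeff_exampleLaurent_eq_zero
    coeff_exampleLaurent_three_ne_zero Even.zero coeff_exampleLaurent_zero_ne_zero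

theorem supportParam_sq_add_sq (p : ℝ → ℝ) (θ : ℝ) :
    supportParam p θ 0 ^ 2 + supportParam p θ 1 ^ 2 = p θ ^ 2 + deriv p θ ^ 2 := by
  simp only [supportParam, PiLp.toLp_apply, Matrix.cons_val_zero, Matrix.cons_val_one]
  linear_combination (p θ ^ 2 + deriv p θ ^ 2) * cos_sq_add_sin_sq θ

-- The real part of `(x + iy)³ = (p(θ) + i p'(θ))³ exp(3iθ)`.
theorem supportParam_cube_sub (p : ℝ → ℝ) (θ : ℝ) :
    supportParam p θ 0 ^ 3 - 3 * supportParam p θ 0 * supportParam p θ 1 ^ 2 =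
      (p θ ^ 3 - 3 * p θ * deriv p θ ^ 2) * cos (3 * θ) -
        (3 * p θ ^ 2 * deriv p θ - deriv p θ ^ 3) * sin (3 * θ) := by
  have hcos : cos (3 * θ) = cos θ ^ 3 - 3 * cos θ * sin θ ^ 2 := by
    rw [cos_three_mul]
    linear_combination (3 * cos θ) * cos_sq_add_sin_sq θ
  have hsin : sin (3 * θ) = 3 * cos θ ^ 2 * sin θ - sin θ ^ 3 := by
    rw [sin_three_mul]
    linear_combination (-3 * sin θ) * cos_sq_add_sin_sq θ
  simp only [supportParam, PiLp.toLp_apply, Matrix.cons_val_zero, Matrix.cons_val_one, hcos, hsin]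
  ring

open MvPolynomial

/-- `x² + y² - 81/256`, which equals `-(1 - cos 3θ)² / 32` on the example curve. -/
noncomputable def exampleQuadric : MvPolynomial (Fin 2) ℝ := X 0 ^ 2 + X 1 ^ 2 - C (81 / 256)

/-- A quartic which equals `-(1 - cos 3θ)³ / 128` on the example curve. -/
noncomputable def exampleQuartic : MvPolynomial (Fin 2) ℝ :=
  exampleQuadric ^ 2 + C (1 / 2) * (X 0 ^ 3 - C 3 * X 0 * X 1 ^ 2) - C (27 / 64) * exampleQuadric -
    C (729 / 8192)

/-- The defining polynomial of the example curve, obtained by eliminating `1 - cos 3θ` from the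
values of `exampleQuadric` and `exampleQuartic`. -/
noncomputable def exampleOctic : MvPolynomial (Fin 2) ℝ :=
  exampleQuartic ^ 2 + C 2 * exampleQuadric ^ 3

theorem eval_exampleQuadric (θ : ℝ) :
    eval (fun i => supportParam exampleSupport θ i) exampleQuadric =
      -(1 - cos (3 * θ)) ^ 2 / 32 := by
  simp only [exampleQuadric, map_sub, map_add, map_pow, eval_X, eval_C, supportParam_sq_add_sq,
    deriv_exampleSupport, exampleSupport]
  linear_combination 9 / 256 * cos_sq_add_sin_sq (3 * θ)

theorem eval_exampleQuartic (θ : ℝ) :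
    eval (fun i => supportParam exampleSupport θ i) exampleQuartic =
      -(1 - cos (3 * θ)) ^ 3 / 128 := by
  have hsin := sin_sq (3 * θ)
  simp only [exampleQuartic, map_sub, map_add, map_mul, map_pow, eval_X, eval_C,
    eval_exampleQuadric, supportParam_cube_sub, deriv_exampleSupport, exampleSupport]
  grind

theorem vanishesOn_exampleOctic : VanishesOn exampleOctic (supportCurve exampleSupport) := by
  rintro _ ⟨θ, -, rfl⟩
  simp only [exampleOctic, map_add, map_mul, map_pow, eval_C, eval_exampleQuadric,
    eval_exampleQuartic]
  ring

theorem exists_finSuccEquiv_exampleOctic_eq : ∃ b c d e f m t : MvPolynomial (Fin 1) ℝ,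
    finSuccEquiv ℝ 1 exampleOctic =
      ((Polynomial.X ^ 2 + Polynomial.C b) ^ 2 +
        Polynomial.C c * (Polynomial.X ^ 3 - Polynomial.C d * Polynomial.X * Polynomial.C e ^ 2) -
        Polynomial.C f * (Polynomial.X ^ 2 + Polynomial.C b) - Polynomial.C m) ^ 2 +
      Polynomial.C t * (Polynomial.X ^ 2 + Polynomial.C b) ^ 3 := by
  refine ⟨X 0 ^ 2 - C (81 / 256), C (1 / 2), C 3, X 0, C (27 / 64), C (729 / 8192), C 2, ?_⟩
  have hC (r : ℝ) : finSuccEquiv ℝ 1 (C r) = Polynomial.C (C r) :=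
    (finSuccEquiv_apply ℝ 1 (C r)).trans (eval₂Hom_C _ _ r)
  have hY : finSuccEquiv ℝ 1 (X 1) = Polynomial.C (X 0) := finSuccEquiv_X_succ (j := 0)
  simp only [exampleOctic, exampleQuartic, exampleQuadric, map_add, map_sub, map_mul, map_pow,
    finSuccEquiv_X_zero, hY, hC, add_sub_assoc]

theorem monic_finSuccEquiv_exampleOctic : (finSuccEquiv ℝ 1 exampleOctic).Monic := by
  obtain ⟨b, c, d, e, f, m, t, h⟩ := exists_finSuccEquiv_exampleOctic_eq
  rw [h]
  monicity!

theorem degreeOf_zero_exampleOctic : exampleOctic.degreeOf 0 = 8 := by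
  obtain ⟨b, c, d, e, f, m, t, h⟩ := exists_finSuccEquiv_exampleOctic_eq
  rw [← natDegree_finSuccEquiv, h]
  compute_degree!

theorem totalDegree_exampleQuadric_le : exampleQuadric.totalDegree ≤ 2 := by
  have hX (i : Fin 2) : (X i ^ 2 : MvPolynomial (Fin 2) ℝ).totalDegree ≤ 2 :=
    (totalDegree_X_pow i 2).le
  exact (totalDegree_sub_C_le _ _).trans ((totalDegree_add _ _).trans (max_le (hX 0) (hX 1)))

theorem totalDegree_exampleQuartic_le : exampleQuartic.totalDegree ≤ 4 := by
  have hCmul (t : ℝ) (g : MvPolynomial (Fin 2) ℝ) : (C t * g).totalDegree ≤ g.totalDegree := by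
    rw [C_mul']
    exact totalDegree_smul_le t g
  have hquadric : (exampleQuadric ^ 2).totalDegree ≤ 4 :=
    (totalDegree_pow _ _).trans (Nat.mul_le_mul_left 2 totalDegree_exampleQuadric_le)
  have hxy : (C 3 * X 0 * X 1 ^ 2 : MvPolynomial (Fin 2) ℝ).totalDegree ≤ 3 :=
    (totalDegree_mul _ _).trans <| Nat.add_le_add
      ((hCmul 3 (X 0)).trans (totalDegree_X 0).le) (totalDegree_X_pow 1 2).le
  have hcubic : (X 0 ^ 3 - C 3 * X 0 * X 1 ^ 2 : MvPolynomial (Fin 2) ℝ).totalDegree ≤ 3 :=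
    (totalDegree_sub _ _).trans (max_le (totalDegree_X_pow 0 3).le hxy)
  refine (totalDegree_sub_C_le _ _).trans <| (totalDegree_sub _ _).trans <| max_le
    ((totalDegree_add _ _).trans <| max_le hquadric ?_) ?_
  · exact (hCmul _ _).trans (hcubic.trans (by norm_num))
  · exact (hCmul _ _).trans (totalDegree_exampleQuadric_le.trans (by norm_num))

theorem totalDegree_exampleOctic_le : exampleOctic.totalDegree ≤ 8 := by
  refine (totalDegree_add _ _).trans (max_le ?_ ?_)
  · exact (totalDegree_pow _ _).trans (Nat.mul_le_mul_left 2 totalDegree_exampleQuartic_le)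
  · rw [C_mul']
    exact (totalDegree_smul_le _ _).trans <| (totalDegree_pow _ _).trans <|
      (Nat.mul_le_mul_left 3 totalDegree_exampleQuadric_le).trans (by norm_num)

theorem totalDegree_exampleOctic : exampleOctic.totalDegree = 8 :=
  totalDegree_exampleOctic_le.antisymm (degreeOf_zero_exampleOctic ▸ degreeOf_le_totalDegree _ 0)

theorem isDefiningPolynomial_exampleOctic :
    IsDefiningPolynomial exampleOctic (supportCurve exampleSupport) := by
  refine isDefiningPolynomial_of_monic ofReal_exampleSupport monic_finSuccEquiv_exampleOctic
    vanishesOn_exampleOctic fun g hg hgp => ?_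
  rw [degreeOf_zero_exampleOctic]
  exact two_mul_succ_le_degreeOf_of_vanishesOn ofReal_exampleSupport (by norm_num)
    coeff_exampleLaurent_eq_zero coeff_exampleLaurent_three_ne_zero Even.zero
    coeff_exampleLaurent_zero_ne_zero hg hgp

end Example

theorem corollary2p1_general :
    (∀ (α : ℝ) (p : ℝ → ℝ), α ≠ 0 → IsOddTrigPolynomial α p → ¬ IsCircle (supportCurve p) →
      ∀ g : MvPolynomial (Fin 2) ℝ, g ≠ 0 → VanishesOn g (supportCurve p) → 8 ≤ g.totalDegree) ∧
    (IsConstantWidthSupport 1 exampleSupport ∧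
      ¬ IsCircle (supportCurve exampleSupport) ∧
      ∃ f : MvPolynomial (Fin 2) ℝ,
        IsDefiningPolynomial f (supportCurve exampleSupport) ∧ f.totalDegree = 8) :=
  ⟨fun _ _ hα hp hcirc g hg hgp =>
      (hp.eight_le_degreeOf hα hcirc hg hgp).trans (g.degreeOf_le_totalDegree 0),
    isConstantWidthSupport_exampleSupport, not_isCircle_supportCurve_exampleSupport, exampleOctic,
    isDefiningPolynomial_exampleOctic, totalDegree_exampleOctic⟩

theorem corollary2p1 :
    -- the minimal degree of a defining polynomial is 8
    IsLeast {d : ℕ | ∃ (α : ℝ) (C : Set (EuclideanSpace ℝ (Fin 2)))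
        (f : MvPolynomial (Fin 2) ℝ),
        IsAlgebraicCurveOfConstantWidth α C ∧ ¬ IsCircle C ∧
          IsDefiningPolynomial f C ∧ f.totalDegree = d} 8 ∧
    -- no nonzero polynomial at all of degree below 8 vanishes on such a curve
    (∀ (α : ℝ) (C : Set (EuclideanSpace ℝ (Fin 2))),
        IsAlgebraicCurveOfConstantWidth α C → ¬ IsCircle C →
          ∀ g : MvPolynomial (Fin 2) ℝ, g ≠ 0 → VanishesOn g C → 8 ≤ g.totalDegree) ∧
    -- the degree 8 is attained by `p = 1/2 + (1/16) cos 3θ`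
    (IsConstantWidthSupport 1 exampleSupport ∧
      ¬ IsCircle (supportCurve exampleSupport) ∧
      ∃ f : MvPolynomial (Fin 2) ℝ,
        IsDefiningPolynomial f (supportCurve exampleSupport) ∧ f.totalDegree = 8) := by
  obtain ⟨lower, hwidth, hcirc, f, hf, hdeg⟩ := corollary2p1_general
  refine ⟨⟨⟨1, _, f, ⟨_, hwidth, rfl⟩, hcirc, hf, hdeg⟩, ?_⟩, ?_, hwidth, hcirc, f, hf, hdeg⟩
  · rintro _ ⟨α, _, g, ⟨p, ⟨hα, hp, -⟩, rfl⟩, hC, hg, rfl⟩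
    exact lower α p hα.ne' hp hC g hg.1.ne_zero ((hg.2 g).mpr dvd_rfl)
  · rintro α _ ⟨p, ⟨hα, hp, -⟩, rfl⟩
    exact lower α p hα.ne' hp
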